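/- Theorem 4 (General sufficient condition). Let $\mathcal H$ be a separable complex Hilbert space and let $\rho$ be a state (density operator) on the Hilbert tensor product $\mathcal H\otimes\mathcal H$. A density source-operator (DSO) for $\rho$ is a positive trace class operator $R$ on $\mathcal H\otimes\mathcal H\otimes\mathcal H$ such that either $\mathrm{tr}^{(2)}[R]=\mathrm{tr}^{(3)}[R]=\rho$ (type $R_{\blacktriangleright}$) or $\mathrm{tr}^{(1)}[R]=\mathrm{tr}^{(2)}[R]=\rho$ (type $R_{\blacktriangleleft}$), where $\mathrm{tr}^{(k)}$ is the partial trace over the $k$-th tensor factor; $\rho$ is called a DSO state if it has a density source-operator. Let $\rho$ be a DSO state on $\mathcal H\otimes\mathcal H$, and let $W_2,\widetilde W_2$ be bounded self-adjoint operators on $\mathcal H$ with operator norms $\le 1$. Suppose that there is a density source-operator $R_{\blacktriangleright}$ for $\rho$ such that, for one choice of the sign, $$\mathrm{tr}[\sigma_{R_{\blacktriangleright}}(W_2\otimes\widetilde W_2)]=\pm\,\mathrm{tr}[\rho(W_2\otimes\widetilde W_2)],\qquad \sigma_{R_{\blacktriangleright}}=\mathrm{tr}^{(1)}[R_{\blacktriangleright}].$$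 Then, for every bounded self-adjoint operator $W_1$ on $\mathcal H$ with $\|W_1\|\le 1$, $$\bigl|\mathrm{tr}[\rho(W_1\otimes W_2)]-\mathrm{tr}[\rho(W_1\otimes\widetilde W_2)]\bigr|\le 1\mp\mathrm{tr}[\rho(W_2\otimes\widetilde W_2)],$$ with the minus sign (perfect correlation form of the original Bell inequality) if the hypothesis holds with the plus sign, and the plus sign (anticorrelation form) if the hypothesis holds with the minus sign. -/

import Mathlib

open scoped TensorProduct ComplexOrder

namespace QSource

noncomputable section

/-! ### Hilbert tensor products -/

section Spaces

variable (E F G : Type*) [NormedAddCommGroup E] [InnerProductSpace ℂ E]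
  [NormedAddCommGroup F] [InnerProductSpace ℂ F]
  [NormedAddCommGroup G] [InnerProductSpace ℂ G]

/-- The Hilbert space tensor product `E ⊗ F`: the completion of the algebraic tensor product with
respect to the inner product `⟪x ⊗ y, x' ⊗ y'⟫ = ⟪x, x'⟫ ⟪y, y'⟫`. -/
def HTensor₂ : Type _ := UniformSpace.Completion (E ⊗[ℂ] F)

instance : NormedAddCommGroup (HTensor₂ E F) :=
  inferInstanceAs (NormedAddCommGroup (UniformSpace.Completion (E ⊗[ℂ] F)))

instance : InnerProductSpace ℂ (HTensor₂ E F) :=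
  inferInstanceAs (InnerProductSpace ℂ (UniformSpace.Completion (E ⊗[ℂ] F)))

instance : CompleteSpace (HTensor₂ E F) :=
  inferInstanceAs (CompleteSpace (UniformSpace.Completion (E ⊗[ℂ] F)))

/-- The Hilbert space tensor product `E ⊗ F ⊗ G` of three spaces. -/
def HTensor₃ : Type _ := UniformSpace.Completion (E ⊗[ℂ] F ⊗[ℂ] G)

instance : NormedAddCommGroup (HTensor₃ E F G) :=
  inferInstanceAs (NormedAddCommGroup (UniformSpace.Completion (E ⊗[ℂ] F ⊗[ℂ] G)))

instance : InnerProductSpace ℂ (HTensor₃ E F G) :=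
  inferInstanceAs (InnerProductSpace ℂ (UniformSpace.Completion (E ⊗[ℂ] F ⊗[ℂ] G)))

instance : CompleteSpace (HTensor₃ E F G) :=
  inferInstanceAs (CompleteSpace (UniformSpace.Completion (E ⊗[ℂ] F ⊗[ℂ] G)))

end Spaces

section Tensor

variable {E F G : Type*} [NormedAddCommGroup E] [InnerProductSpace ℂ E]
  [NormedAddCommGroup F] [InnerProductSpace ℂ F]
  [NormedAddCommGroup G] [InnerProductSpace ℂ G]

/-- The bounded operator `A ⊗ B` on the Hilbert space `E ⊗ F`. -/
def opTensor (A : E →L[ℂ] E) (B : F →L[ℂ] F) : HTensor₂ E F →L[ℂ] HTensor₂ E F :=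
  (TensorProduct.mapL A B).completion

/-- For `e : E`, the bounded operator `F ⊗ G → E ⊗ F ⊗ G` with `y ⊗ z ↦ e ⊗ y ⊗ z`. -/
def insert₁ (F G : Type*) [NormedAddCommGroup F] [InnerProductSpace ℂ F]
    [NormedAddCommGroup G] [InnerProductSpace ℂ G] (e : E) :
    HTensor₂ F G →L[ℂ] HTensor₃ E F G :=
  ((TensorProduct.mkL ℂ E F e).rTensor G).completion

/-- For `f : F`, the bounded operator `E ⊗ G → E ⊗ F ⊗ G` with `x ⊗ z ↦ x ⊗ f ⊗ z`. -/
def insert₂ (E G : Type*) [NormedAddCommGroup E] [InnerProductSpace ℂ E]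
    [NormedAddCommGroup G] [InnerProductSpace ℂ G] (f : F) :
    HTensor₂ E G →L[ℂ] HTensor₃ E F G :=
  (((TensorProduct.mkL ℂ E F).flip f).rTensor G).completion

/-- For `g : G`, the bounded operator `E ⊗ F → E ⊗ F ⊗ G` with `x ⊗ y ↦ x ⊗ y ⊗ g`. -/
def insert₃ (E F : Type*) [NormedAddCommGroup E] [InnerProductSpace ℂ E]
    [NormedAddCommGroup F] [InnerProductSpace ℂ F] (g : G) :
    HTensor₂ E F →L[ℂ] HTensor₃ E F G :=
  ((TensorProduct.mkL ℂ (E ⊗[ℂ] F) G).flip g).completion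

end Tensor

/-! ### Trace class operators, trace, partial traces -/

section Trace

variable {K : Type*} [NormedAddCommGroup K] [InnerProductSpace ℂ K] [CompleteSpace K]

/-- The index set of a chosen orthonormal (Hilbert) basis of `K`. -/
def basisIndex (K : Type*) [NormedAddCommGroup K] [InnerProductSpace ℂ K] [CompleteSpace K] :
    Set K :=
  (exists_hilbertBasis ℂ K).choose

/-- A chosen orthonormal (Hilbert) basis of `K`. The notions below do not depend on the choice. -/
def basis (K : Type*) [NormedAddCommGroup K] [InnerProductSpace ℂ K] [CompleteSpace K] :
    HilbertBasis (basisIndex K) ℂ K :=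
  (exists_hilbertBasis ℂ K).choose_spec.choose

/-- `A` is trace class: `∑ᵢ ⟪eᵢ, |A| eᵢ⟫ < ∞`, where `|A| = √(A† A)`. -/
def IsTraceClass (A : K →L[ℂ] K) : Prop :=
  Summable fun i => inner ℂ (basis K i) (CFC.abs A (basis K i))

/-- The trace `tr[A] = ∑ᵢ ⟪eᵢ, A eᵢ⟫` of a trace class operator `A`. -/
def trace (A : K →L[ℂ] K) : ℂ :=
  ∑' i, inner ℂ (basis K i) (A (basis K i))

/-- A (normal) state, i.e. a density operator: positive, trace class, of trace one. -/
structure IsState (ρ : K →L[ℂ] K) : Prop where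
  isPositive : ρ.IsPositive
  isTraceClass : IsTraceClass ρ
  trace_eq_one : trace ρ = 1

variable {E F G : Type*} [NormedAddCommGroup E] [InnerProductSpace ℂ E]
  [NormedAddCommGroup F] [InnerProductSpace ℂ F]
  [NormedAddCommGroup G] [InnerProductSpace ℂ G]

/-- The partial trace of a trace class operator on `E ⊗ F ⊗ G` over the first factor: the operator
`∑ᵢ (⟨eᵢ| ⊗ I ⊗ I) T (|eᵢ⟩ ⊗ I ⊗ I)` on `F ⊗ G`. -/
def partialTrace₁ [CompleteSpace E] (T : HTensor₃ E F G →L[ℂ] HTensor₃ E F G) :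
    HTensor₂ F G →L[ℂ] HTensor₂ F G :=
  ∑' i, ContinuousLinearMap.adjoint (insert₁ F G (basis E i)) ∘L T ∘L insert₁ F G (basis E i)

/-- The partial trace of a trace class operator on `E ⊗ F ⊗ G` over the second factor. -/
def partialTrace₂ [CompleteSpace F] (T : HTensor₃ E F G →L[ℂ] HTensor₃ E F G) :
    HTensor₂ E G →L[ℂ] HTensor₂ E G :=
  ∑' i, ContinuousLinearMap.adjoint (insert₂ E G (basis F i)) ∘L T ∘L insert₂ E G (basis F i)

/-- The partial trace of a trace class operator on `E ⊗ F ⊗ G` over the third factor. -/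
def partialTrace₃ [CompleteSpace G] (T : HTensor₃ E F G →L[ℂ] HTensor₃ E F G) :
    HTensor₂ E F →L[ℂ] HTensor₂ E F :=
  ∑' i, ContinuousLinearMap.adjoint (insert₃ E F (basis G i)) ∘L T ∘L insert₃ E F (basis G i)

end Trace

/-! ### Source-operators and DSO states -/

section Source

variable {H₁ H₂ : Type*} [NormedAddCommGroup H₁] [InnerProductSpace ℂ H₁] [CompleteSpace H₁]
  [NormedAddCommGroup H₂] [InnerProductSpace ℂ H₂] [CompleteSpace H₂]

/-- `T` on `H₁ ⊗ H₂ ⊗ H₂` is a source-operator `T₁₂₂` for `ρ` on `H₁ ⊗ H₂`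
(written `T_▶` if `H₁ = H₂`). -/
structure IsSourceOperator₁₂₂ (ρ : HTensor₂ H₁ H₂ →L[ℂ] HTensor₂ H₁ H₂)
    (T : HTensor₃ H₁ H₂ H₂ →L[ℂ] HTensor₃ H₁ H₂ H₂) : Prop where
  isSelfAdjoint : IsSelfAdjoint T
  isTraceClass : IsTraceClass T
  partialTrace₂_eq : partialTrace₂ T = ρ
  partialTrace₃_eq : partialTrace₃ T = ρ

/-- `T` on `H₁ ⊗ H₁ ⊗ H₂` is a source-operator `T₁₁₂` for `ρ` on `H₁ ⊗ H₂`
(written `T_◀` if `H₁ = H₂`). -/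
structure IsSourceOperator₁₁₂ (ρ : HTensor₂ H₁ H₂ →L[ℂ] HTensor₂ H₁ H₂)
    (T : HTensor₃ H₁ H₁ H₂ →L[ℂ] HTensor₃ H₁ H₁ H₂) : Prop where
  isSelfAdjoint : IsSelfAdjoint T
  isTraceClass : IsTraceClass T
  partialTrace₁_eq : partialTrace₁ T = ρ
  partialTrace₂_eq : partialTrace₂ T = ρ

/-- A density source-operator of type `122`: a positive source-operator. -/
def IsDensitySourceOperator₁₂₂ (ρ : HTensor₂ H₁ H₂ →L[ℂ] HTensor₂ H₁ H₂)
    (R : HTensor₃ H₁ H₂ H₂ →L[ℂ] HTensor₃ H₁ H₂ H₂) : Prop :=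
  IsSourceOperator₁₂₂ ρ R ∧ R.IsPositive

/-- A density source-operator of type `112`: a positive source-operator. -/
def IsDensitySourceOperator₁₁₂ (ρ : HTensor₂ H₁ H₂ →L[ℂ] HTensor₂ H₁ H₂)
    (R : HTensor₃ H₁ H₁ H₂ →L[ℂ] HTensor₃ H₁ H₁ H₂) : Prop :=
  IsSourceOperator₁₁₂ ρ R ∧ R.IsPositive

/-- A DSO state: a state that has a density source-operator (of either type). -/
def IsDSOState (ρ : HTensor₂ H₁ H₂ →L[ℂ] HTensor₂ H₁ H₂) : Prop :=
  IsState ρ ∧ ((∃ R, IsDensitySourceOperator₁₂₂ ρ R) ∨ ∃ R, IsDensitySourceOperator₁₁₂ ρ R)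

end Source

end

end QSource

/-! Put `A = W₁ ⊗ 1 ⊗ 1`, `B = 1 ⊗ W₂ ⊗ 1`, `C = 1 ⊗ 1 ⊗ W₂'`. These commute and lie between `-1`
and `1`, so `(1 + A)(1 - B)(1 + C) + (1 - A)(1 + B)(1 - C) = 2(1 - BC - AB + AC)` is positive. Pair
it with `R`: the partial traces over factors 3 and 2 turn the `AB` and `AC` terms into traces
against `ρ`, the one over factor 1 turns `BC` into the `σ` term, and `tr R = tr ρ = 1`. The sign
change `W₁ ↦ -W₁` supplies the absolute value, and the hypothesis on `σ` is then substituted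
(`opTensor₃_bell`, `trace_bell_nonneg`, `norm_trace_sub_le`).

The analytic work justifies `tr[tr⁽ᵏ⁾[R] X] = tr[R Y]`, with `Y` the extension of `X` by the
identity (`IsTensorEmbedding.trace_tsum_mul`). Writing `R = D²` with `D` Hilbert-Schmidt makes
traces independent of the basis and makes the partial trace series converge in operator norm.
`IsTensorEmbedding` treats the three tensor factors uniformly. -/

namespace HilbertBasis

/-! ### Hilbert-Schmidt sums in Hilbert bases. -/

variable {ι κ K L : Type*} [NormedAddCommGroup K] [InnerProductSpace ℂ K]
  [NormedAddCommGroup L] [InnerProductSpace ℂ L]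

theorem hasSum_norm_inner_sq (b : HilbertBasis ι ℂ K) (x : K) :
    HasSum (fun i => ‖inner ℂ (b i) x‖ ^ 2) (‖x‖ ^ 2) := by
  have h := b.hasSum_inner_mul_inner x x
  have h1 : ∀ i, inner ℂ x (b i) * inner ℂ (b i) x = ((‖inner ℂ (b i) x‖ ^ 2 : ℝ) : ℂ) := by
    intro i
    rw [← inner_conj_symm x (b i), ← Complex.normSq_eq_conj_mul_self, Complex.normSq_eq_norm_sq]
  have h2 : inner ℂ x x = ((‖x‖ ^ 2 : ℝ) : ℂ) := by
    rw [inner_self_eq_norm_sq_to_K]; simp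
  simp only [h1, h2] at h
  exact Complex.hasSum_ofReal.mp h

theorem summable_norm_inner_sq_prod (b : HilbertBasis ι ℂ K) (c : HilbertBasis κ ℂ L)
    (A : K →L[ℂ] L) (hA : Summable fun i => ‖A (b i)‖ ^ 2) :
    Summable fun p : ι × κ => ‖inner ℂ (c p.2) (A (b p.1))‖ ^ 2 := by
  have h0 : (0 : ι × κ → ℝ) ≤ fun p => ‖inner ℂ (c p.2) (A (b p.1))‖ ^ 2 :=
    fun p => pow_nonneg (norm_nonneg _) 2
  rw [summable_prod_of_nonneg h0]
  refine ⟨fun i => (c.hasSum_norm_inner_sq (A (b i))).summable, ?_⟩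
  simpa only [(c.hasSum_norm_inner_sq _).tsum_eq] using hA

variable [CompleteSpace K] [CompleteSpace L]

/-- The double series of squared matrix coefficients may be summed along rows or columns. For
self-adjoint `A` this transfers the Hilbert-Schmidt condition from one basis to another. -/
theorem summable_norm_adjoint_sq (b : HilbertBasis ι ℂ K) (c : HilbertBasis κ ℂ L)
    (A : K →L[ℂ] L) (hA : Summable fun i => ‖A (b i)‖ ^ 2) :
    Summable fun j => ‖ContinuousLinearMap.adjoint A (c j)‖ ^ 2 := by
  have h := ((b.summable_norm_inner_sq_prod c A hA).comp_injective
    (Prod.swap_injective (α := κ) (β := ι))).prod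
  refine h.congr fun j => ?_
  rw [← (b.hasSum_norm_inner_sq _).tsum_eq]
  refine tsum_congr fun i => ?_
  simp only [Function.comp, Prod.swap, ContinuousLinearMap.adjoint_inner_right]
  rw [norm_inner_symm]

/-- Passing to the adjoint, the coefficients of `A† y` are `⟪A (b i), y⟫`; Cauchy-Schwarz on each
and Parseval give the bound. -/
theorem opNorm_le_sqrt_tsum (b : HilbertBasis ι ℂ K) (A : K →L[ℂ] L)
    (hA : Summable fun i => ‖A (b i)‖ ^ 2) : ‖A‖ ≤ √(∑' i, ‖A (b i)‖ ^ 2) := by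
  rw [← LinearIsometryEquiv.norm_map ContinuousLinearMap.adjoint A]
  refine ContinuousLinearMap.opNorm_le_bound _ (Real.sqrt_nonneg _) fun y => ?_
  refine le_of_sq_le_sq ?_ (by positivity)
  rw [mul_pow, Real.sq_sqrt (tsum_nonneg fun _ => sq_nonneg _)]
  refine hasSum_le (fun i => ?_) (b.hasSum_norm_inner_sq _) (hA.hasSum.mul_right (‖y‖ ^ 2))
  rw [ContinuousLinearMap.adjoint_inner_right, ← mul_pow]
  exact pow_le_pow_left₀ (norm_nonneg _) (norm_inner_le_norm _ _) 2

/-- The Hilbert-Schmidt pairing of two Hilbert-Schmidt operators is computed in any basis of the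
domain, or by the adjoints in any basis of the codomain. -/
theorem hasSum_inner_of_summable (b : HilbertBasis ι ℂ K) (c : HilbertBasis κ ℂ L)
    (A B : K →L[ℂ] L) (hA : Summable fun i => ‖A (b i)‖ ^ 2)
    (hB : Summable fun i => ‖B (b i)‖ ^ 2) :
    HasSum (fun i => inner ℂ (A (b i)) (B (b i)))
      (∑' j, inner ℂ (ContinuousLinearMap.adjoint B (c j)) (ContinuousLinearMap.adjoint A (c j))) := by
  -- Absolute convergence, from `|zw| ≤ |z|² + |w|²`, permits summing in either order.
  have hs : Summable fun p : ι × κ =>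
      inner ℂ (A (b p.1)) (c p.2) * inner ℂ (c p.2) (B (b p.1)) := by
    refine Summable.of_norm_bounded ((b.summable_norm_inner_sq_prod c A hA).add
      (b.summable_norm_inner_sq_prod c B hB)) fun p => ?_
    rw [norm_mul, norm_inner_symm (A (b p.1))]
    nlinarith [sq_nonneg (‖inner ℂ (c p.2) (A (b p.1))‖ - ‖inner ℂ (c p.2) (B (b p.1))‖),
      sq_nonneg (‖inner ℂ (c p.2) (A (b p.1))‖ + ‖inner ℂ (c p.2) (B (b p.1))‖)]
  have h1 : ∀ i, HasSum (fun j => inner ℂ (A (b i)) (c j) * inner ℂ (c j) (B (b i)))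
      (inner ℂ (A (b i)) (B (b i))) := fun i => c.hasSum_inner_mul_inner _ _
  have h2 : ∀ j, HasSum (fun i => inner ℂ (A (b i)) (c j) * inner ℂ (c j) (B (b i)))
      (inner ℂ (ContinuousLinearMap.adjoint B (c j)) (ContinuousLinearMap.adjoint A (c j))) := by
    intro j
    have h := b.hasSum_inner_mul_inner (ContinuousLinearMap.adjoint B (c j))
      (ContinuousLinearMap.adjoint A (c j))
    simp only [ContinuousLinearMap.adjoint_inner_left (A := B) (y := c j) (x := b _),
      ContinuousLinearMap.adjoint_inner_right A (b _)] at h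
    simpa only [mul_comm] using h
  have h3 := hs.hasSum.prod_fiberwise h1
  have h4 := ((Equiv.prodComm κ ι).hasSum_iff.mpr hs.hasSum).prod_fiberwise h2
  rw [h4.tsum_eq]
  exact h3

/-- For a Hilbert-Schmidt self-adjoint `D`, the trace of `D * D * Y` in an arbitrary basis. -/
theorem hasSum_inner_mul_self_apply (b : HilbertBasis ι ℂ K) (c : HilbertBasis κ ℂ K)
    (D : K →L[ℂ] K) (hD : IsSelfAdjoint D) (hs : Summable fun i => ‖D (c i)‖ ^ 2)
    (Y : K →L[ℂ] K) :
    HasSum (fun i => inner ℂ (b i) ((D * D * Y) (b i)))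
      (∑' j, inner ℂ (D (c j)) (Y (D (c j)))) := by
  have hD' : ContinuousLinearMap.adjoint D = D := hD.adjoint_eq
  have hb : Summable fun i => ‖D (b i)‖ ^ 2 := by
    simpa only [hD'] using c.summable_norm_adjoint_sq b D hs
  have hadj : ContinuousLinearMap.adjoint (D * Y) = ContinuousLinearMap.adjoint Y * D := by
    rw [← ContinuousLinearMap.star_eq_adjoint, star_mul, hD.star_eq,
      ContinuousLinearMap.star_eq_adjoint]
  have hY : Summable fun i => ‖(D * Y) (b i)‖ ^ 2 := by
    have h : Summable fun i => ‖(ContinuousLinearMap.adjoint (D * Y)) (c i)‖ ^ 2 := by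
      refine Summable.of_nonneg_of_le (fun _ => sq_nonneg _) (fun i => ?_)
        (hs.mul_left (‖ContinuousLinearMap.adjoint Y‖ ^ 2))
      rw [hadj, ← mul_pow]
      exact pow_le_pow_left₀ (norm_nonneg _)
        ((ContinuousLinearMap.adjoint Y).le_opNorm (D (c i))) 2
    simpa only [ContinuousLinearMap.adjoint_adjoint] using c.summable_norm_adjoint_sq b _ h
  -- Moving one `D` to the left gives the pairing of `D` with `D * Y`; its expression through
  -- adjoints in `c` no longer involves `b`.
  have key := b.hasSum_inner_of_summable c D (D * Y) hb hY
  rw [hadj, hD'] at key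
  convert key using 2 with i
  · change inner ℂ (b i) (D ((D * Y) (b i))) = _
    rw [← ContinuousLinearMap.adjoint_inner_left, hD']
  · ext j
    exact (ContinuousLinearMap.adjoint_inner_left Y (D (c j)) (D (c j))).symm

end HilbertBasis

namespace QSource

/-! ### Traces against a positive trace class operator. -/

variable {K : Type*} [NormedAddCommGroup K] [InnerProductSpace ℂ K] [CompleteSpace K]

/-- Take `D = √R`. Since `|R| = R`, the trace class sum is `∑ ‖D eᵢ‖²`. -/
theorem exists_mul_self_of_isTraceClass {R : K →L[ℂ] K} (hR : R.IsPositive)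
    (ht : IsTraceClass R) :
    ∃ D : K →L[ℂ] K, IsSelfAdjoint D ∧ R = D * D ∧ Summable fun i => ‖D (basis K i)‖ ^ 2 := by
  have h0 : 0 ≤ R := (ContinuousLinearMap.nonneg_iff_isPositive R).mpr hR
  have hD : IsSelfAdjoint (CFC.sqrt R) := IsSelfAdjoint.of_nonneg (CFC.sqrt_nonneg R)
  have hDD : CFC.sqrt R * CFC.sqrt R = R := CFC.sqrt_mul_sqrt_self R h0
  refine ⟨CFC.sqrt R, hD, hDD.symm, ?_⟩
  rw [IsTraceClass, CFC.abs_of_nonneg R h0] at ht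
  refine Complex.summable_ofReal.mp (ht.congr fun i => ?_)
  conv_lhs => rw [← hDD]
  change inner ℂ (basis K i) (CFC.sqrt R (CFC.sqrt R (basis K i))) = _
  rw [← ContinuousLinearMap.adjoint_inner_left, hD.adjoint_eq, inner_self_eq_norm_sq_to_K]
  simp

/-- Basis independence: every basis yields the same value `∑ ⟪D eⱼ, Y (D eⱼ)⟫`. -/
theorem hasSum_trace {ι : Type*} (b : HilbertBasis ι ℂ K) {R : K →L[ℂ] K} (hR : R.IsPositive)
    (ht : IsTraceClass R) (Y : K →L[ℂ] K) :
    HasSum (fun i => inner ℂ (b i) ((R * Y) (b i))) (trace (R * Y)) := by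
  obtain ⟨D, hD, rfl, hs⟩ := exists_mul_self_of_isTraceClass hR ht
  rw [trace, ((basis K).hasSum_inner_mul_self_apply _ D hD hs Y).tsum_eq]
  exact b.hasSum_inner_mul_self_apply _ D hD hs Y

theorem trace_mul_add {R : K →L[ℂ] K} (hR : R.IsPositive) (ht : IsTraceClass R)
    (Y Z : K →L[ℂ] K) : trace (R * (Y + Z)) = trace (R * Y) + trace (R * Z) := by
  refine (hasSum_trace (basis K) hR ht (Y + Z)).unique ?_
  simpa only [mul_add, add_apply, inner_add_right] using
    (hasSum_trace (basis K) hR ht Y).add (hasSum_trace (basis K) hR ht Z)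

theorem trace_mul_smul {R : K →L[ℂ] K} (hR : R.IsPositive) (ht : IsTraceClass R)
    (a : ℂ) (Y : K →L[ℂ] K) : trace (R * (a • Y)) = a * trace (R * Y) := by
  refine (hasSum_trace (basis K) hR ht (a • Y)).unique ?_
  simpa only [mul_smul_comm, smul_apply, inner_smul_right] using
    (hasSum_trace (basis K) hR ht Y).mul_left a

theorem trace_mul_nonneg {R : K →L[ℂ] K} (hR : R.IsPositive) (ht : IsTraceClass R)
    {Y : K →L[ℂ] K} (hY : Y.IsPositive) : 0 ≤ trace (R * Y) := by
  obtain ⟨D, hD, rfl, hs⟩ := exists_mul_self_of_isTraceClass hR ht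
  rw [trace, ((basis K).hasSum_inner_mul_self_apply _ D hD hs Y).tsum_eq]
  exact tsum_nonneg fun i => hY.inner_nonneg_right _

/-! ### Partial traces along an abstract tensor embedding. -/

section Embedding

variable {H L : Type*} [NormedAddCommGroup H] [InnerProductSpace ℂ H]
  [NormedAddCommGroup L] [InnerProductSpace ℂ L] [CompleteSpace L]

/-- A linear family of operators `K → L`, indexed by vectors of `H`, that exhibits `L` as the
Hilbert tensor product of `H` and `K`. -/
structure IsTensorEmbedding (J : H →ₗ[ℂ] K →L[ℂ] L) : Prop where
  inner_apply : ∀ h h' x x', inner ℂ (J h x) (J h' x') = inner ℂ h h' * inner ℂ x x'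
  eq_zero : ∀ v : L, (∀ h x, inner ℂ v (J h x) = 0) → v = 0

variable {J : H →ₗ[ℂ] K →L[ℂ] L} {ι κ : Type*}

omit [CompleteSpace K] [CompleteSpace L] in
theorem IsTensorEmbedding.norm_apply (hJ : IsTensorEmbedding J) (h : H) (x : K) :
    ‖J h x‖ = ‖h‖ * ‖x‖ := by
  have := hJ.inner_apply h h x x
  simp only [inner_self_eq_norm_sq_to_K] at this
  rw [← mul_pow] at this
  have h2 : ‖J h x‖ ^ 2 = (‖h‖ * ‖x‖) ^ 2 := by exact_mod_cast this
  exact (sq_eq_sq₀ (norm_nonneg _) (by positivity)).mp h2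

omit [CompleteSpace K] in
theorem IsTensorEmbedding.exists_hilbertBasis (hJ : IsTensorEmbedding J)
    (g : HilbertBasis ι ℂ H) (k : HilbertBasis κ ℂ K) :
    ∃ c : HilbertBasis (ι × κ) ℂ L, ∀ p, c p = J (g p.1) (k p.2) := by
  classical
  have ho : Orthonormal ℂ fun p : ι × κ => J (g p.1) (k p.2) := by
    rw [orthonormal_iff_ite]
    rintro ⟨i, j⟩ ⟨i', j'⟩
    rw [hJ.inner_apply, orthonormal_iff_ite.mp g.orthonormal, orthonormal_iff_ite.mp k.orthonormal]
    simp only [Prod.mk.injEq]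
    split_ifs <;> simp_all
  refine ⟨HilbertBasis.mkOfOrthogonalEqBot ho ?_, fun p => by rw [HilbertBasis.coe_mkOfOrthogonalEqBot]⟩
  rw [Submodule.eq_bot_iff]
  intro v hv
  have hv' : ∀ i j, inner ℂ v (J (g i) (k j)) = 0 := fun i j =>
    Submodule.inner_left_of_mem_orthogonal (Submodule.subset_span (Set.mem_range_self (i, j))) hv
  have h1 : ∀ i x, inner ℂ v (J (g i) x) = 0 := by
    intro i x
    have : innerSL ℂ v ∘L J (g i) = 0 :=
      ContinuousLinearMap.ext_on (Submodule.dense_iff_topologicalClosure_eq_top.mpr k.dense_span)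
        (by rintro _ ⟨j, rfl⟩; exact hv' i j)
    exact DFunLike.congr_fun this x
  refine hJ.eq_zero v fun h x => ?_
  -- `J` is only assumed linear in `h`; the norm identity provides the continuity needed for the
  -- density argument.
  let φ : H →L[ℂ] ℂ := innerSL ℂ v ∘L LinearMap.mkContinuous
    ((ContinuousLinearMap.coeLM ℂ ∘ₗ J).flip x) ‖x‖
      (fun h => by simp [hJ.norm_apply, mul_comm])
  have : φ = 0 :=
    ContinuousLinearMap.ext_on (Submodule.dense_iff_topologicalClosure_eq_top.mpr g.dense_span)
      (by rintro _ ⟨i, rfl⟩; exact h1 i x)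
  exact DFunLike.congr_fun this h

/-- Each term has norm `‖D ∘L J (g i)‖²`, at most a squared Hilbert-Schmidt norm, and these add up
to that of `D` in the product basis. Without summability the `tsum` defining a partial trace could
be the default value 0. -/
theorem IsTensorEmbedding.summable_norm_adjoint_comp (hJ : IsTensorEmbedding J)
    (g : HilbertBasis ι ℂ H) {R : L →L[ℂ] L} (hR : R.IsPositive) (ht : IsTraceClass R) :
    Summable fun i => ‖ContinuousLinearMap.adjoint (J (g i)) ∘L R ∘L J (g i)‖ := by
  obtain ⟨D, hD, rfl, hs⟩ := exists_mul_self_of_isTraceClass hR ht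
  obtain ⟨c, hc⟩ := hJ.exists_hilbertBasis g (basis K)
  have hsum : Summable fun p => ‖D (c p)‖ ^ 2 := by
    simpa only [hD.adjoint_eq] using (basis L).summable_norm_adjoint_sq c D hs
  refine Summable.of_nonneg_of_le (fun _ => norm_nonneg _) (fun i => ?_) hsum.prod
  have hfib : Summable fun j => ‖(D ∘L J (g i)) (basis K j)‖ ^ 2 := by
    have h := hsum.prod_factor i
    simp only [hc] at h
    exact h
  have heq : ContinuousLinearMap.adjoint (J (g i)) ∘L (D * D) ∘L J (g i) =
      ContinuousLinearMap.adjoint (D ∘L J (g i)) ∘L (D ∘L J (g i)) := by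
    rw [ContinuousLinearMap.adjoint_comp, hD.adjoint_eq]; rfl
  rw [heq, ContinuousLinearMap.norm_adjoint_comp_self]
  have hle : ‖D ∘L J (g i)‖ ≤ √(∑' j, ‖(D ∘L J (g i)) (basis K j)‖ ^ 2) := by
    refine (basis K).opNorm_le_sqrt_tsum _ hfib
  calc _ ≤ _ := mul_self_le_mul_self (norm_nonneg _) hle
    _ = ∑' j, ‖(D ∘L J (g i)) (basis K j)‖ ^ 2 :=
      Real.mul_self_sqrt (tsum_nonneg fun _ => sq_nonneg _)
    _ = _ := by simp only [hc]; rfl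

/-- The defining property of a partial trace. -/
theorem IsTensorEmbedding.trace_tsum_mul (hJ : IsTensorEmbedding J)
    (g : HilbertBasis ι ℂ H) {R : L →L[ℂ] L} (hR : R.IsPositive) (ht : IsTraceClass R)
    (X : K →L[ℂ] K) (Y : L →L[ℂ] L) (hXY : ∀ h x, Y (J h x) = J h (X x)) :
    trace ((∑' i, ContinuousLinearMap.adjoint (J (g i)) ∘L R ∘L J (g i)) * X) =
      trace (R * Y) := by
  obtain ⟨c, hc⟩ := hJ.exists_hilbertBasis g (basis K)
  -- The swap makes the basis of `K` the outer index, so each inner sum is one matrix coefficient of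
  -- the partial trace.
  have h := (Equiv.prodComm _ _).hasSum_iff.mpr (hasSum_trace c hR ht Y)
  have hS := (hJ.summable_norm_adjoint_comp g hR ht).of_norm.hasSum
  refine (h.prod_fiberwise fun j => ?_).tsum_eq
  -- Matrix coefficients are continuous in the operator, so they pass through the series.
  have h1 := ((innerSL ℂ (basis K j)) ∘L
    (ContinuousLinearMap.apply ℂ K (X (basis K j)))).hasSum hS
  have h2 : ∀ i, inner ℂ (c (i, j)) (R (Y (c (i, j)))) = inner ℂ (basis K j)
      (ContinuousLinearMap.adjoint (J (g i)) (R (J (g i) (X (basis K j))))) := fun i => by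
    rw [hc, hXY, ContinuousLinearMap.adjoint_inner_right]
  change HasSum (fun i => inner ℂ (c (i, j)) (R (Y (c (i, j))))) _
  simp only [h2]
  exact h1

end Embedding

end QSource

/-- In the complex order the two hypotheses force `s` and `d` to be real, so reality of the traces
needs no separate proof. -/
theorem Complex.norm_le_of_sub_nonneg_of_add_nonneg {s d : ℂ} (h1 : 0 ≤ s - d)
    (h2 : 0 ≤ s + d) : ((‖d‖ : ℝ) : ℂ) ≤ s := by
  rw [Complex.le_def] at h1 h2 ⊢
  simp only [zero_re, zero_im, sub_re, sub_im, add_re, add_im, ofReal_re, ofReal_im] at *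
  have hd : d = (d.re : ℂ) := Complex.ext rfl (by simp only [ofReal_im]; linarith)
  refine ⟨?_, by linarith⟩
  rw [hd, Complex.norm_real, Real.norm_eq_abs, abs_le]
  constructor <;> linarith

namespace QSource

open TensorProduct

/-! ### Pure tensors and operators on the concrete tensor products. -/

section Pure

variable {E F G M : Type*} [NormedAddCommGroup E] [InnerProductSpace ℂ E]
  [NormedAddCommGroup F] [InnerProductSpace ℂ F]
  [NormedAddCommGroup G] [InnerProductSpace ℂ G]
  [NormedAddCommGroup M] [InnerProductSpace ℂ M]

/-- The pure tensor `x ⊗ y` in `E ⊗ F`. -/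
noncomputable def pure₂ (x : E) (y : F) : HTensor₂ E F :=
  ((x ⊗ₜ[ℂ] y : E ⊗[ℂ] F) : UniformSpace.Completion (E ⊗[ℂ] F))

/-- The pure tensor `x ⊗ y ⊗ z` in `E ⊗ F ⊗ G`. -/
noncomputable def pure₃ (x : E) (y : F) (z : G) : HTensor₃ E F G :=
  ((x ⊗ₜ[ℂ] y ⊗ₜ[ℂ] z : E ⊗[ℂ] F ⊗[ℂ] G) : UniformSpace.Completion (E ⊗[ℂ] F ⊗[ℂ] G))

theorem inner_pure₂ (x x' : E) (y y' : F) :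
    inner ℂ (pure₂ x y) (pure₂ x' y') = inner ℂ x x' * inner ℂ y y' :=
  UniformSpace.Completion.inner_coe _ _

theorem inner_pure₃ (x x' : E) (y y' : F) (z z' : G) :
    inner ℂ (pure₃ x y z) (pure₃ x' y' z') = inner ℂ x x' * inner ℂ y y' * inner ℂ z z' :=
  UniformSpace.Completion.inner_coe _ _

theorem clm_ext_completion {V : Type*} [NormedAddCommGroup V] [InnerProductSpace ℂ V]
    {S T : UniformSpace.Completion V →L[ℂ] M} (h : ∀ v : V, S v = T v) : S = T := by
  ext x
  exact UniformSpace.Completion.induction_on x (isClosed_eq S.continuous T.continuous) h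

theorem clm_ext_completion_of_linear {V : Type*} [NormedAddCommGroup V] [InnerProductSpace ℂ V]
    {S T : UniformSpace.Completion V →L[ℂ] M}
    (h : (S ∘L UniformSpace.Completion.toComplL : V →L[ℂ] M).toLinearMap =
      (T ∘L UniformSpace.Completion.toComplL : V →L[ℂ] M).toLinearMap) : S = T :=
  clm_ext_completion (LinearMap.congr_fun h)

theorem coe_completion_smul {V : Type*} [NormedAddCommGroup V] [InnerProductSpace ℂ V] (a : ℂ)
    (v : V) : ((a • v : V) : UniformSpace.Completion V) = a • (v : UniformSpace.Completion V) :=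
  UniformSpace.Completion.coe_smul a v

theorem clm_ext₂ {S T : HTensor₂ E F →L[ℂ] M} (h : ∀ x y, S (pure₂ x y) = T (pure₂ x y)) :
    S = T :=
  clm_ext_completion_of_linear (S := S) (T := T) (TensorProduct.ext' h)

theorem clm_ext₃ {S T : HTensor₃ E F G →L[ℂ] M}
    (h : ∀ x y z, S (pure₃ x y z) = T (pure₃ x y z)) : S = T :=
  clm_ext_completion_of_linear (S := S) (T := T) (TensorProduct.ext_threefold h)

theorem eq_of_inner_pure₂ {v w : HTensor₂ E F}
    (h : ∀ x y, inner ℂ v (pure₂ x y) = inner ℂ w (pure₂ x y)) : v = w :=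
  innerSL_inj.mp (clm_ext₂ (S := innerSL ℂ v) (T := innerSL ℂ w) h)

theorem eq_of_inner_pure₃ {v w : HTensor₃ E F G}
    (h : ∀ x y z, inner ℂ v (pure₃ x y z) = inner ℂ w (pure₃ x y z)) : v = w :=
  innerSL_inj.mp (clm_ext₃ (S := innerSL ℂ v) (T := innerSL ℂ w) h)

theorem opTensor_pure₂ (A : E →L[ℂ] E) (B : F →L[ℂ] F) (x : E) (y : F) :
    opTensor A B (pure₂ x y) = pure₂ (A x) (B y) :=
  ContinuousLinearMap.completion_apply_coe _ _

theorem insert₁_pure₂ (x : E) (y : F) (z : G) : insert₁ F G x (pure₂ y z) = pure₃ x y z :=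
  ContinuousLinearMap.completion_apply_coe _ _

theorem insert₂_pure₂ (x : E) (y : F) (z : G) : insert₂ E G y (pure₂ x z) = pure₃ x y z :=
  ContinuousLinearMap.completion_apply_coe _ _

theorem insert₃_pure₂ (x : E) (y : F) (z : G) : insert₃ E F z (pure₂ x y) = pure₃ x y z :=
  ContinuousLinearMap.completion_apply_coe _ _

theorem pure₃_add_left (x x' : E) (y : F) (z : G) :
    pure₃ (x + x') y z = pure₃ x y z + pure₃ x' y z := by
  unfold pure₃
  rw [add_tmul, add_tmul]
  exact UniformSpace.Completion.coe_add _ _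

theorem pure₃_add_middle (x : E) (y y' : F) (z : G) :
    pure₃ x (y + y') z = pure₃ x y z + pure₃ x y' z := by
  unfold pure₃
  rw [tmul_add, add_tmul]
  exact UniformSpace.Completion.coe_add _ _

theorem pure₃_add_right (x : E) (y : F) (z z' : G) :
    pure₃ x y (z + z') = pure₃ x y z + pure₃ x y z' := by
  unfold pure₃
  rw [tmul_add]
  exact UniformSpace.Completion.coe_add _ _

theorem pure₃_smul_left (a : ℂ) (x : E) (y : F) (z : G) :
    pure₃ (a • x) y z = a • pure₃ x y z := by
  unfold pure₃
  rw [← smul_tmul', ← smul_tmul']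
  exact coe_completion_smul a (x ⊗ₜ[ℂ] y ⊗ₜ[ℂ] z)

theorem pure₃_smul_middle (a : ℂ) (x : E) (y : F) (z : G) :
    pure₃ x (a • y) z = a • pure₃ x y z := by
  unfold pure₃
  rw [tmul_smul, ← smul_tmul']
  exact coe_completion_smul a (x ⊗ₜ[ℂ] y ⊗ₜ[ℂ] z)

theorem pure₃_smul_right (a : ℂ) (x : E) (y : F) (z : G) :
    pure₃ x y (a • z) = a • pure₃ x y z := by
  unfold pure₃
  rw [tmul_smul]
  exact coe_completion_smul a (x ⊗ₜ[ℂ] y ⊗ₜ[ℂ] z)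

variable (E F G)

/-- `insert₁` as a linear map of the inserted vector. -/
noncomputable def insertₗ₁ : E →ₗ[ℂ] HTensor₂ F G →L[ℂ] HTensor₃ E F G where
  toFun := insert₁ F G
  map_add' x x' := clm_ext₂ fun y z => by
    simp only [add_apply, insert₁_pure₂, pure₃_add_left]
  map_smul' a x := clm_ext₂ fun y z => by
    simp only [smul_apply, insert₁_pure₂, pure₃_smul_left, RingHom.id_apply]

/-- `insert₂` as a linear map of the inserted vector. -/
noncomputable def insertₗ₂ : F →ₗ[ℂ] HTensor₂ E G →L[ℂ] HTensor₃ E F G where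
  toFun := insert₂ E G
  map_add' x x' := clm_ext₂ fun y z => by
    simp only [add_apply, insert₂_pure₂, pure₃_add_middle]
  map_smul' a x := clm_ext₂ fun y z => by
    simp only [smul_apply, insert₂_pure₂, pure₃_smul_middle, RingHom.id_apply]

/-- `insert₃` as a linear map of the inserted vector. -/
noncomputable def insertₗ₃ : G →ₗ[ℂ] HTensor₂ E F →L[ℂ] HTensor₃ E F G where
  toFun := insert₃ E F
  map_add' x x' := clm_ext₂ fun y z => by
    simp only [add_apply, insert₃_pure₂, pure₃_add_right]
  map_smul' a x := clm_ext₂ fun y z => by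
    simp only [smul_apply, insert₃_pure₂, pure₃_smul_right, RingHom.id_apply]

variable {E F G}

/-- Operators on `E ⊗ F` intertwine inner products as soon as they do so on pure tensors. -/
theorem inner_map_map_of_pure₂ [CompleteSpace M] (S T : HTensor₂ E F →L[ℂ] M) (a : ℂ)
    (h : ∀ x y x' y', inner ℂ (S (pure₂ x y)) (T (pure₂ x' y')) =
      a * (inner ℂ x x' * inner ℂ y y')) (u v : HTensor₂ E F) :
    inner ℂ (S u) (T v) = a * inner ℂ u v := by
  have h1 : ∀ x y v, inner ℂ (S (pure₂ x y)) (T v) = a * inner ℂ (pure₂ x y) v := by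
    intro x y v
    have : innerSL ℂ (S (pure₂ x y)) ∘L T = a • innerSL ℂ (pure₂ x y) :=
      clm_ext₂ fun x' y' => by
        change inner ℂ (S (pure₂ x y)) (T (pure₂ x' y')) = a * inner ℂ (pure₂ x y) (pure₂ x' y')
        rw [h, inner_pure₂]
    exact DFunLike.congr_fun this v
  -- The identity with a pure left argument says `S† T = a • 1`, which then covers every left
  -- argument.
  have h2 : ContinuousLinearMap.adjoint S (T v) = a • v := by
    refine eq_of_inner_pure₂ fun x y => ?_
    rw [← inner_conj_symm, ← inner_conj_symm (a • v), ContinuousLinearMap.adjoint_inner_right,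
      h1, inner_smul_right]
  rw [← ContinuousLinearMap.adjoint_inner_right, h2, inner_smul_right]

theorem isTensorEmbedding_insertₗ₁ : IsTensorEmbedding (insertₗ₁ E F G) where
  inner_apply h h' := inner_map_map_of_pure₂ (insert₁ F G h) (insert₁ F G h') _
    fun x y x' y' => by rw [insert₁_pure₂, insert₁_pure₂, inner_pure₃]; ring
  eq_zero v hv := eq_of_inner_pure₃ fun x y z => by
    rw [inner_zero_left, ← insert₁_pure₂]; exact hv _ _

theorem isTensorEmbedding_insertₗ₂ : IsTensorEmbedding (insertₗ₂ E F G) where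
  inner_apply h h' := inner_map_map_of_pure₂ (insert₂ E G h) (insert₂ E G h') _
    fun x y x' y' => by rw [insert₂_pure₂, insert₂_pure₂, inner_pure₃]; ring
  eq_zero v hv := eq_of_inner_pure₃ fun x y z => by
    rw [inner_zero_left, ← insert₂_pure₂]; exact hv _ _

theorem isTensorEmbedding_insertₗ₃ : IsTensorEmbedding (insertₗ₃ E F G) where
  inner_apply h h' := inner_map_map_of_pure₂ (insert₃ E F h) (insert₃ E F h') _
    fun x y x' y' => by rw [insert₃_pure₂, insert₃_pure₂, inner_pure₃]; ring
  eq_zero v hv := eq_of_inner_pure₃ fun x y z => by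
    rw [inner_zero_left, ← insert₃_pure₂]; exact hv _ _

/-- The bounded operator `A ⊗ B ⊗ C` on the Hilbert space `E ⊗ F ⊗ G`. -/
noncomputable def opTensor₃ (A : E →L[ℂ] E) (B : F →L[ℂ] F) (C : G →L[ℂ] G) :
    HTensor₃ E F G →L[ℂ] HTensor₃ E F G :=
  (TensorProduct.mapL (TensorProduct.mapL A B) C).completion

theorem opTensor₃_pure₃ (A : E →L[ℂ] E) (B : F →L[ℂ] F) (C : G →L[ℂ] G) (x : E) (y : F) (z : G) :
    opTensor₃ A B C (pure₃ x y z) = pure₃ (A x) (B y) (C z) :=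
  ContinuousLinearMap.completion_apply_coe _ _

theorem opTensor₃_insert₁ (A : F →L[ℂ] F) (B : G →L[ℂ] G) (e : E) (t : HTensor₂ F G) :
    opTensor₃ 1 A B (insert₁ F G e t) = insert₁ F G e (opTensor A B t) := by
  have : opTensor₃ 1 A B ∘L insert₁ F G e = insert₁ F G e ∘L opTensor A B :=
    clm_ext₂ fun x y => by
      simp only [ContinuousLinearMap.comp_apply, insert₁_pure₂, opTensor₃_pure₃, opTensor_pure₂,
        one_apply_eq_self]
  exact DFunLike.congr_fun this t

theorem opTensor₃_insert₂ (A : E →L[ℂ] E) (B : G →L[ℂ] G) (f : F) (t : HTensor₂ E G) :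
    opTensor₃ A 1 B (insert₂ E G f t) = insert₂ E G f (opTensor A B t) := by
  have : opTensor₃ A 1 B ∘L insert₂ E G f = insert₂ E G f ∘L opTensor A B :=
    clm_ext₂ fun x y => by
      simp only [ContinuousLinearMap.comp_apply, insert₂_pure₂, opTensor₃_pure₃, opTensor_pure₂,
        one_apply_eq_self]
  exact DFunLike.congr_fun this t

theorem opTensor₃_insert₃ (A : E →L[ℂ] E) (B : F →L[ℂ] F) (g : G) (t : HTensor₂ E F) :
    opTensor₃ A B 1 (insert₃ E F g t) = insert₃ E F g (opTensor A B t) := by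
  have : opTensor₃ A B 1 ∘L insert₃ E F g = insert₃ E F g ∘L opTensor A B :=
    clm_ext₂ fun x y => by
      simp only [ContinuousLinearMap.comp_apply, insert₃_pure₂, opTensor₃_pure₃, opTensor_pure₂,
        one_apply_eq_self]
  exact DFunLike.congr_fun this t

theorem opTensor_one : opTensor (1 : E →L[ℂ] E) (1 : F →L[ℂ] F) = 1 :=
  clm_ext₂ fun x y => by simp only [opTensor_pure₂, one_apply_eq_self]

theorem opTensor₃_mul (A A' : E →L[ℂ] E) (B B' : F →L[ℂ] F) (C C' : G →L[ℂ] G) :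
    opTensor₃ (A * A') (B * B') (C * C') = opTensor₃ A B C * opTensor₃ A' B' C' :=
  clm_ext₃ fun x y z => by
    change _ = opTensor₃ A B C (opTensor₃ A' B' C' (pure₃ x y z))
    simp only [opTensor₃_pure₃]
    rfl

theorem adjoint_opTensor₃ [CompleteSpace E] [CompleteSpace F] [CompleteSpace G]
    (A : E →L[ℂ] E) (B : F →L[ℂ] F) (C : G →L[ℂ] G) :
    ContinuousLinearMap.adjoint (opTensor₃ A B C) =
      opTensor₃ (ContinuousLinearMap.adjoint A) (ContinuousLinearMap.adjoint B)
        (ContinuousLinearMap.adjoint C) :=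
  clm_ext₃ fun x y z => eq_of_inner_pure₃ fun x' y' z' => by
    rw [ContinuousLinearMap.adjoint_inner_left, opTensor₃_pure₃, opTensor₃_pure₃, inner_pure₃,
      inner_pure₃]
    simp only [ContinuousLinearMap.adjoint_inner_left]

/-- The operator is `X† X`, with `X` the tensor product of the square roots. -/
theorem isPositive_opTensor₃ [CompleteSpace E] [CompleteSpace F] [CompleteSpace G]
    {A : E →L[ℂ] E} {B : F →L[ℂ] F} {C : G →L[ℂ] G} (hA : 0 ≤ A) (hB : 0 ≤ B) (hC : 0 ≤ C) :
    (opTensor₃ A B C).IsPositive := by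
  have key : opTensor₃ A B C = ContinuousLinearMap.adjoint
      (opTensor₃ (CFC.sqrt A) (CFC.sqrt B) (CFC.sqrt C)) ∘L
        opTensor₃ (CFC.sqrt A) (CFC.sqrt B) (CFC.sqrt C) := by
    rw [adjoint_opTensor₃, (IsSelfAdjoint.of_nonneg (CFC.sqrt_nonneg A)).adjoint_eq,
      (IsSelfAdjoint.of_nonneg (CFC.sqrt_nonneg B)).adjoint_eq,
      (IsSelfAdjoint.of_nonneg (CFC.sqrt_nonneg C)).adjoint_eq]
    rw [← ContinuousLinearMap.mul_def]
    rw [← opTensor₃_mul, CFC.sqrt_mul_sqrt_self A hA, CFC.sqrt_mul_sqrt_self B hB,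
      CFC.sqrt_mul_sqrt_self C hC]
  rw [key]
  exact ContinuousLinearMap.isPositive_adjoint_comp_self _

/-! ### The trace identity for the three concrete partial traces. -/

section PartialTrace

variable [CompleteSpace E] [CompleteSpace F] [CompleteSpace G]
  {R : HTensor₃ E F G →L[ℂ] HTensor₃ E F G} (hR : R.IsPositive) (ht : IsTraceClass R)
include hR ht

omit [CompleteSpace F] [CompleteSpace G] in
theorem trace_partialTrace₁_mul (A : F →L[ℂ] F) (B : G →L[ℂ] G) :
    trace (partialTrace₁ R * opTensor A B) = trace (R * opTensor₃ 1 A B) :=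
  isTensorEmbedding_insertₗ₁.trace_tsum_mul (basis E) hR ht _ _ (opTensor₃_insert₁ A B)

omit [CompleteSpace E] [CompleteSpace G] in
theorem trace_partialTrace₂_mul (A : E →L[ℂ] E) (B : G →L[ℂ] G) :
    trace (partialTrace₂ R * opTensor A B) = trace (R * opTensor₃ A 1 B) :=
  isTensorEmbedding_insertₗ₂.trace_tsum_mul (basis F) hR ht _ _ (opTensor₃_insert₂ A B)

omit [CompleteSpace E] [CompleteSpace F] in
theorem trace_partialTrace₃_mul (A : E →L[ℂ] E) (B : F →L[ℂ] F) :
    trace (partialTrace₃ R * opTensor A B) = trace (R * opTensor₃ A B 1) :=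
  isTensorEmbedding_insertₗ₃.trace_tsum_mul (basis G) hR ht _ _ (opTensor₃_insert₃ A B)

end PartialTrace

/-- The two positive operators that add up to `1 - BC - A(B - C)` for commuting `A`, `B`, `C`. -/
theorem opTensor₃_bell (A : E →L[ℂ] E) (B : F →L[ℂ] F) (C : G →L[ℂ] G) :
    opTensor₃ (1 + A) (1 + -B) (1 + C) + opTensor₃ (1 + -A) (1 + B) (1 + -C) =
      (2 : ℂ) • (opTensor₃ 1 1 1 + (-1 : ℂ) • opTensor₃ 1 B C +
        (-1 : ℂ) • opTensor₃ A B 1 + opTensor₃ A 1 C) :=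
  clm_ext₃ fun x y z => by
    -- Negations become scalars `-1` so that multilinearity of `pure₃` expands everything.
    simp only [add_apply, smul_apply, neg_apply, opTensor₃_pure₃, one_apply_eq_self,
      ← neg_one_smul ℂ (A x), ← neg_one_smul ℂ (B y), ← neg_one_smul ℂ (C z),
      pure₃_add_left, pure₃_add_middle, pure₃_add_right, pure₃_smul_left, pure₃_smul_middle,
      pure₃_smul_right]
    module

end Pure

/-! ### The Bell inequality. -/

section Bell

variable {E F G : Type*} [NormedAddCommGroup E] [InnerProductSpace ℂ E] [CompleteSpace E]
  [NormedAddCommGroup F] [InnerProductSpace ℂ F] [CompleteSpace F]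
  [NormedAddCommGroup G] [InnerProductSpace ℂ G] [CompleteSpace G]

/-- `-A ≤ ‖A‖ ≤ 1` in the operator order. -/
theorem one_add_nonneg_of_norm_le_one {A : E →L[ℂ] E} (hA : IsSelfAdjoint A) (h : ‖A‖ ≤ 1) :
    0 ≤ 1 + A := by
  have h1 := hA.neg.le_algebraMap_norm_self
  rw [norm_neg] at h1
  have h2 : algebraMap ℝ (E →L[ℂ] E) ‖A‖ ≤ algebraMap ℝ (E →L[ℂ] E) 1 := algebraMap_mono _ h
  rw [map_one] at h2
  simpa using neg_le_iff_add_nonneg.mp (h1.trans h2)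

variable {R : HTensor₃ E F G →L[ℂ] HTensor₃ E F G} (hR : R.IsPositive) (ht : IsTraceClass R)
include hR ht

theorem trace_bell_nonneg {A : E →L[ℂ] E} {B : F →L[ℂ] F} {C : G →L[ℂ] G}
    (hA : IsSelfAdjoint A) (hB : IsSelfAdjoint B) (hC : IsSelfAdjoint C)
    (hA1 : ‖A‖ ≤ 1) (hB1 : ‖B‖ ≤ 1) (hC1 : ‖C‖ ≤ 1) :
    0 ≤ trace (R * opTensor₃ 1 1 1) - trace (R * opTensor₃ 1 B C) -
      (trace (R * opTensor₃ A B 1) - trace (R * opTensor₃ A 1 C)) := by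
  have p := one_add_nonneg_of_norm_le_one hA hA1
  have q := one_add_nonneg_of_norm_le_one hB hB1
  have r := one_add_nonneg_of_norm_le_one hC hC1
  have p' := one_add_nonneg_of_norm_le_one hA.neg (by rwa [norm_neg])
  have q' := one_add_nonneg_of_norm_le_one hB.neg (by rwa [norm_neg])
  have r' := one_add_nonneg_of_norm_le_one hC.neg (by rwa [norm_neg])
  have h := trace_mul_nonneg hR ht
    ((isPositive_opTensor₃ p q' r).add (isPositive_opTensor₃ p' q r'))
  rw [opTensor₃_bell] at h
  simp only [trace_mul_smul hR ht, trace_mul_add hR ht] at h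
  have h' := mul_nonneg (by positivity : (0 : ℂ) ≤ 1 / 2) h
  convert h' using 1
  ring

/-- The Bell inequality for a positive trace class operator on `E ⊗ F ⊗ G`. -/
theorem norm_trace_sub_le {A : E →L[ℂ] E} {B : F →L[ℂ] F} {C : G →L[ℂ] G}
    (hA : IsSelfAdjoint A) (hB : IsSelfAdjoint B) (hC : IsSelfAdjoint C)
    (hA1 : ‖A‖ ≤ 1) (hB1 : ‖B‖ ≤ 1) (hC1 : ‖C‖ ≤ 1) :
    ((‖trace (R * opTensor₃ A B 1) - trace (R * opTensor₃ A 1 C)‖ : ℝ) : ℂ) ≤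
      trace (R * opTensor₃ 1 1 1) - trace (R * opTensor₃ 1 B C) := by
  have h1 := trace_bell_nonneg hR ht hA hB hC hA1 hB1 hC1
  -- Negating `A` flips the sign of the difference of traces only.
  have h2 := trace_bell_nonneg hR ht hA.neg hB hC (by rwa [norm_neg]) hB1 hC1
  have e1 : opTensor₃ (-A) B (1 : G →L[ℂ] G) = (-1 : ℂ) • opTensor₃ A B 1 :=
    clm_ext₃ fun x y z => by
      simp only [opTensor₃_pure₃, smul_apply, neg_apply, ← neg_one_smul ℂ (A x), pure₃_smul_left]
  have e2 : opTensor₃ (-A) (1 : F →L[ℂ] F) C = (-1 : ℂ) • opTensor₃ A 1 C :=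
    clm_ext₃ fun x y z => by
      simp only [opTensor₃_pure₃, smul_apply, neg_apply, ← neg_one_smul ℂ (A x), pure₃_smul_left]
  rw [e1, e2, trace_mul_smul hR ht, trace_mul_smul hR ht] at h2
  refine Complex.norm_le_of_sub_nonneg_of_add_nonneg h1 ?_
  convert h2 using 1
  ring

end Bell

theorem norm_trace_sub_le_of_isDensitySourceOperator {H₁ H₂ : Type*}
    [NormedAddCommGroup H₁] [InnerProductSpace ℂ H₁] [CompleteSpace H₁]
    [NormedAddCommGroup H₂] [InnerProductSpace ℂ H₂] [CompleteSpace H₂]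
    {ρ : HTensor₂ H₁ H₂ →L[ℂ] HTensor₂ H₁ H₂} (hρ : IsState ρ)
    {R : HTensor₃ H₁ H₂ H₂ →L[ℂ] HTensor₃ H₁ H₂ H₂} (hR : IsDensitySourceOperator₁₂₂ ρ R)
    {W₁ : H₁ →L[ℂ] H₁} {W₂ W₂' : H₂ →L[ℂ] H₂} (hW₁ : IsSelfAdjoint W₁)
    (hW₂ : IsSelfAdjoint W₂) (hW₂' : IsSelfAdjoint W₂')
    (hW₁_norm : ‖W₁‖ ≤ 1) (hW₂_norm : ‖W₂‖ ≤ 1) (hW₂'_norm : ‖W₂'‖ ≤ 1) :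
    ((‖trace (ρ * opTensor W₁ W₂) - trace (ρ * opTensor W₁ W₂')‖ : ℝ) : ℂ) ≤
      1 - trace (partialTrace₁ R * opTensor W₂ W₂') := by
  obtain ⟨⟨-, ht, h2, h3⟩, hpos⟩ := hR
  have h := norm_trace_sub_le hpos ht hW₁ hW₂ hW₂' hW₁_norm hW₂_norm hW₂'_norm
  -- The constant 1 is `tr R = tr ρ`, obtained from the third partial trace against the identity.
  rwa [← trace_partialTrace₁_mul hpos ht W₂ W₂', ← trace_partialTrace₂_mul hpos ht W₁ W₂',
    ← trace_partialTrace₃_mul hpos ht W₁ W₂, ← trace_partialTrace₃_mul hpos ht 1 1, h2, h3,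
    opTensor_one,
    mul_one, hρ.trace_eq_one] at h

end QSource

/-- Original Bell inequality for a DSO state with a density source-operator `R = R_▶`, in its
perfect correlation form (first conjunct) and anticorrelation form (second conjunct).
An inequality `x ≤ y` between complex numbers says that `y - x` is real and nonnegative. -/
theorem theorem4 {H : Type*} [NormedAddCommGroup H] [InnerProductSpace ℂ H] [CompleteSpace H]
    [TopologicalSpace.SeparableSpace H]
    (ρ : QSource.HTensor₂ H H →L[ℂ] QSource.HTensor₂ H H) (hρ : QSource.IsDSOState ρ)
    (R : QSource.HTensor₃ H H H →L[ℂ] QSource.HTensor₃ H H H)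
    (hR : QSource.IsDensitySourceOperator₁₂₂ ρ R)
    (W₂ W₂' : H →L[ℂ] H) (hW₂ : IsSelfAdjoint W₂) (hW₂' : IsSelfAdjoint W₂')
    (hW₂_norm : ‖W₂‖ ≤ 1) (hW₂'_norm : ‖W₂'‖ ≤ 1) :
    (QSource.trace (QSource.partialTrace₁ R * QSource.opTensor W₂ W₂')
          = QSource.trace (ρ * QSource.opTensor W₂ W₂') →
      ∀ W₁ : H →L[ℂ] H, IsSelfAdjoint W₁ → ‖W₁‖ ≤ 1 →
        ((‖QSource.trace (ρ * QSource.opTensor W₁ W₂)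
            - QSource.trace (ρ * QSource.opTensor W₁ W₂')‖ : ℝ) : ℂ)
          ≤ 1 - QSource.trace (ρ * QSource.opTensor W₂ W₂')) ∧
    (QSource.trace (QSource.partialTrace₁ R * QSource.opTensor W₂ W₂')
          = -QSource.trace (ρ * QSource.opTensor W₂ W₂') →
      ∀ W₁ : H →L[ℂ] H, IsSelfAdjoint W₁ → ‖W₁‖ ≤ 1 →
        ((‖QSource.trace (ρ * QSource.opTensor W₁ W₂)
            - QSource.trace (ρ * QSource.opTensor W₁ W₂')‖ : ℝ) : ℂ)
          ≤ 1 + QSource.trace (ρ * QSource.opTensor W₂ W₂')) := by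
  have key := fun (W₁ : H →L[ℂ] H) (h : IsSelfAdjoint W₁) (h1 : ‖W₁‖ ≤ 1) =>
    QSource.norm_trace_sub_le_of_isDensitySourceOperator hρ.1 hR h hW₂ hW₂' h1 hW₂_norm hW₂'_norm
  refine ⟨fun h W₁ hW₁ h1 => ?_, fun h W₁ hW₁ h1 => ?_⟩
  · simpa only [h] using key W₁ hW₁ h1
  · simpa only [h, sub_neg_eq_add] using key W₁ hW₁ h1
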